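/- **Setting (Narnhofer–Thirring model).** Let $\mathcal A$ be the quasi-local C*-algebra of the spin-$\frac12$ chain over $\mathbb Z$, i.e. the C*-algebra generated by commuting copies of $M_2(\mathbb C)$ at the sites $x\in\mathbb Z$, with Pauli matrices $\vec\sigma_x$. Let $\vec n,\vec m,\vec s\in\mathbb R^3$ be unit vectors with $\vec n\neq\vec m$, let $|\vec n),|\vec m)\in\mathbb C^2$ be unit vectors with $\vec\sigma\cdot\vec n\,|\vec n)=|\vec n)$ and $\vec\sigma\cdot\vec m\,|\vec m)=|\vec m)$, and let $\omega_1,\omega_2$ be the (disjoint) product states of $\mathcal A$ given by $\Omega_1=\bigotimes_{x\in\mathbb Z}|\vec n)$ and $\Omega_2=\bigotimes_{x\in\mathbb Z}|\vec m)$ in the corresponding incomplete tensor products $\mathcal H_1,\mathcal H_2$. For $0<\mu<1$ put $$\omega=\mu\,\omega_1+(1-\mu)\,\omega_2 ,\qquad \Omega_S=\sqrt{\mu}\,\Omega_1\oplus\sqrt{1-\mu}\,\Omega_2\in\mathcal H_S=\mathcal H_1\oplus\mathcal H_2 .$$ The apparatus is a chain of two-level pointers with Hilbert space $\mathcal H_A$,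 the incomplete tensor product along the vector $\Omega_A$ with all pointers down; $\tau_k$ exchanges up and down at the pointer $k$. With $P_k=\frac12(1+\vec\sigma_k\cdot\vec s)$, the measurement of the spin $k$ is $V_k=P_k\otimes 1+(1-P_k)\otimes\tau_k$ on $\mathcal H_S\otimes\mathcal H_A$, and $U$ is the shift of spins and pointers by one site. For an integer $N\ge 0$ of time steps, let $$\Omega(N)=(V_1U)^N(\Omega_S\otimes\Omega_A)=\sum_{\underline\alpha\in\{0,1\}^N}v(\underline\alpha)\otimes\tau_1^{\alpha_1}\cdots\tau_N^{\alpha_N}\Omega_A ,\qquad v(\underline\alpha)\in\mathcal H_S .$$ The probability of the history $\underline\alpha$ is $W_\omega(\underline\alpha)=\|v(\underline\alpha)\|^2$ and, if $W_\omega(\underline\alpha)\ne0$, the collapsed state of the system after reading the pointers in the position $\underline\alpha$ is $\omega_{\underline\alpha}(A)=W_\omega(\underline\alpha)^{-1}\,(v(\underline\alpha),A\,v(\underline\alpha))$, $A\in\mathcal A$. For a state $\varphi$ of $\mathcal A$ and a finite $\Lambda\subset\mathbb Z$, let $\varphi_\Lambda$ be its density matrix on $\bigotimes_{x\in\Lambda}\mathbb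 C^2$ and $S_\Lambda(\varphi)=-\mathrm{Tr}\,\varphi_\Lambda\log\varphi_\Lambda$ (with $0\log0=0$). The mean entropy is $s(\varphi)=\lim_{\Lambda\nearrow\infty}S_\Lambda(\varphi)/|\Lambda|$, the limit being taken in the sense of van Hove. **Theorem 5.1.** $\omega$ is a state and its mean entropy $s(\omega)$ exists. Let $P_{\underline\alpha}=\prod_{i=1}^N Q_i$ with $Q_i=P_i$ if $\alpha_i=0$ and $Q_i=1-P_i$ if $\alpha_i=1$. Then $W_\omega(\underline\alpha)=\omega(P_{\underline\alpha})$ for every $\underline\alpha\in\{0,1\}^N$, and whenever $W_\omega(\underline\alpha)\ne0$, $\omega_{\underline\alpha}$ is a state of $\mathcal A$, $$\omega_{\underline\alpha}(A)=W_\omega(\underline\alpha)^{-1}\,\omega(P_{\underline\alpha}\,A\,P_{\underline\alpha})\qquad(A\in\mathcal A),$$ and the mean entropy $s(\omega_{\underline\alpha})$ exists. The mean entropy is conserved on the average: $$s_{av}:=\sum_{\underline\alpha}W_\omega(\underline\alpha)\,s(\omega_{\underline\alpha})=s(\omega),$$ where terms with $W_\omega(\underline\alpha)=0$ are read as $0$.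 -/

import Mathlib

open scoped ComplexOrder Matrix symmDiff

noncomputable section

namespace SpinChain

/-! ### Operators on Hilbert-space valued `ℓ²` spaces -/

section LTwo

/-- `ℓ²(I; E)`, i.e. the Hilbert space `ℓ²(I) ⊗ E`. -/
abbrev LTwo (I E : Type*) [NormedAddCommGroup E] [InnerProductSpace ℂ E] : Type _ :=
  lp (fun _ : I => E) 2

theorem memlp_of_le {I E : Type*} [NormedAddCommGroup E] {f : I → E} {g : I → ℝ} (hg : Summable g)
    (h : ∀ i, ‖f i‖ ^ 2 ≤ g i) : Memℓp f 2 := by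
  apply memℓp_gen
  have : Summable fun i => ‖f i‖ ^ 2 := Summable.of_nonneg_of_le (fun i => by positivity) h hg
  simpa using this

variable {I E : Type*} [NormedAddCommGroup E] [InnerProductSpace ℂ E]

theorem summable_sq (f : LTwo I E) : Summable fun i => ‖f i‖ ^ 2 := by
  have := (lp.memℓp f).summable (by norm_num)
  simpa using this

theorem norm_sq_eq (f : LTwo I E) : ‖f‖ ^ 2 = ∑' i, ‖f i‖ ^ 2 := by
  have := lp.norm_rpow_eq_tsum (p := 2) (by norm_num) f
  simpa using this

/-- The operator `(f i)_i ↦ (T i (f i))_i` for a uniformly bounded family `T`. -/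
def diagOp (T : I → E →L[ℂ] E) (hT : ∃ C : ℝ, ∀ i, ‖T i‖ ≤ C) : LTwo I E →L[ℂ] LTwo I E :=
  have key : ∀ (C : ℝ), (∀ i, ‖T i‖ ≤ C) → ∀ (f : LTwo I E) (i : I),
      ‖T i (f i)‖ ^ 2 ≤ C ^ 2 * ‖f i‖ ^ 2 := fun C hC f i => by
    rw [← mul_pow]
    gcongr
    exact (T i).le_of_opNorm_le (hC i) _
  LinearMap.mkContinuousOfExistsBound
    { toFun := fun f => ⟨fun i => T i (f i), by
        obtain ⟨C, hC⟩ := hT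
        exact memlp_of_le ((summable_sq f).mul_left (C ^ 2)) (key C hC f)⟩
      map_add' := fun f g => Subtype.ext (funext fun i => (T i).map_add (f i) (g i))
      map_smul' := fun c f => Subtype.ext (funext fun i => (T i).map_smul c (f i)) }
    (by
      obtain ⟨C, hC⟩ := hT
      refine ⟨|C|, fun f => ?_⟩
      refine abs_le_of_sq_le_sq' ?_ (by positivity) |>.2
      rw [mul_pow, sq_abs, norm_sq_eq, norm_sq_eq, ← tsum_mul_left]
      exact (summable_sq _).tsum_le_tsum (key C hC f) ((summable_sq f).mul_left _))

@[simp] theorem diagOp_apply (T : I → E →L[ℂ] E) (hT) (f : LTwo I E) (i : I) :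
    diagOp T hT f i = T i (f i) := rfl

/-- Multiplication by a bounded function. -/
def multOp (c : I → ℂ) (hc : ∃ C : ℝ, ∀ i, ‖c i‖ ≤ C) : LTwo I ℂ →L[ℂ] LTwo I ℂ :=
  diagOp (fun i => ContinuousLinearMap.mul ℂ ℂ (c i))
    (hc.imp fun _ hC i => (ContinuousLinearMap.opNorm_mul_apply_le ℂ ℂ _).trans (hC i))

/-- The unitary operator `f ↦ f ∘ e` for a permutation `e` of the index set. -/
def permOp (e : Equiv.Perm I) : LTwo I E →L[ℂ] LTwo I E :=
  LinearMap.mkContinuousOfExistsBound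
    { toFun := fun f => ⟨fun i => f (e i),
        memlp_of_le (e.summable_iff.mpr (summable_sq f)) fun _ => le_rfl⟩
      map_add' := fun f g => rfl
      map_smul' := fun c f => rfl }
    (by
      refine ⟨1, fun f => ?_⟩
      refine abs_le_of_sq_le_sq' ?_ (by positivity) |>.2
      rw [one_mul, norm_sq_eq, norm_sq_eq]
      exact (e.tsum_eq fun i => ‖f i‖ ^ 2).le)

@[simp] theorem permOp_apply (e : Equiv.Perm I) (f : LTwo I E) (i : I) :
    permOp e f i = f (e i) := rfl

end LTwo

/-- Toggling membership of the site `x` in a finite set of sites. -/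
def flipEquiv (x : ℤ) : Equiv.Perm (Finset ℤ) where
  toFun F := F ∆ {x}
  invFun F := F ∆ {x}
  left_inv F := by simp
  right_inv F := by simp

/-- Translating a finite set of sites by one unit to the left. -/
def translateEquiv : Equiv.Perm (Finset ℤ) := (Equiv.subRight (1 : ℤ)).finsetCongr

/-! ### The spin algebra of the chain -/

/-- Unit vectors of the one-site Hilbert space `ℂ²`. -/
abbrev Spinor : Type := Metric.sphere (0 : EuclideanSpace ℂ (Fin 2)) 1

/-- The unitary matrix with columns `ψ` and `ψ^⊥ = (-conj ψ₁, conj ψ₀)`. -/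
def frame (ψ : Spinor) : Matrix (Fin 2) (Fin 2) ℂ :=
  !![ψ.1 0, -star (ψ.1 1); ψ.1 1, star (ψ.1 0)]

/-- The matrix of `M` in the orthonormal basis `ψ, ψ^⊥` of `ℂ²`. -/
def inFrame (ψ : Spinor) (M : Matrix (Fin 2) (Fin 2) ℂ) : Matrix (Fin 2) (Fin 2) ℂ :=
  (frame ψ)ᴴ * M * frame ψ

/-- The Hilbert space on which the spin algebra is realized: the orthogonal sum, over all unit
vectors `ψ ∈ ℂ²`, of the incomplete tensor products `⊗_{x ∈ ℤ} ℂ²` along the reference vector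
`⊗_x ψ`.  The orthonormal basis vector with index `(ψ, F)` is the product vector which is `ψ^⊥` at
the sites `x ∈ F` and `ψ` at all other sites. -/
abbrev ChainSpace : Type := LTwo (Spinor × Finset ℤ) ℂ

/-- `1` if the site `x` is excited in `F` and `0` otherwise. -/
def occ (x : ℤ) (F : Finset ℤ) : Fin 2 := if x ∈ F then 1 else 0

theorem frame_entry_le (ψ : Spinor) (i j : Fin 2) : ‖frame ψ i j‖ ≤ 1 := by
  have h : ‖ψ.1‖ = 1 := by simp
  have h0 := h ▸ PiLp.norm_apply_le ψ.1 0
  have h1 := h ▸ PiLp.norm_apply_le ψ.1 1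
  fin_cases i <;> fin_cases j <;> simp [frame, h0, h1]

theorem inFrame_entry_le (ψ : Spinor) (M : Matrix (Fin 2) (Fin 2) ℂ) (a b : Fin 2) :
    ‖inFrame ψ M a b‖ ≤ ∑ k, ∑ l, ‖M l k‖ := by
  simp only [inFrame, Matrix.mul_apply]
  refine (norm_sum_le _ _).trans (Finset.sum_le_sum fun k _ => ?_)
  refine (norm_mul_le _ _).trans ?_
  refine (mul_le_of_le_one_right (norm_nonneg _) (frame_entry_le _ _ _)).trans ?_
  refine (norm_sum_le _ _).trans (Finset.sum_le_sum fun l _ => ?_)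
  refine (norm_mul_le _ _).trans ?_
  refine mul_le_of_le_one_left (norm_nonneg _) ?_
  rw [Matrix.conjTranspose_apply, norm_star]
  exact frame_entry_le _ _ _

/-- The one-site observable `M ∈ M₂(ℂ)` placed at the site `x`, as an operator on the chain:
it acts on the tensor factor at `x` by `M` and on all other factors trivially. -/
def siteOp (x : ℤ) (M : Matrix (Fin 2) (Fin 2) ℂ) : ChainSpace →L[ℂ] ChainSpace :=
  multOp (fun i : Spinor × Finset ℤ => inFrame i.1 M (occ x i.2) (occ x i.2))
      ⟨∑ k, ∑ l, ‖M l k‖, fun i => inFrame_entry_le i.1 M _ _⟩ +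
    multOp (fun i : Spinor × Finset ℤ => inFrame i.1 M (occ x i.2) (1 - occ x i.2))
      ⟨∑ k, ∑ l, ‖M l k‖, fun i => inFrame_entry_le i.1 M _ _⟩ ∘L
    permOp (Equiv.prodCongr (Equiv.refl Spinor) (flipEquiv x))

theorem siteOp_apply (x : ℤ) (M : Matrix (Fin 2) (Fin 2) ℂ) (f : ChainSpace) (ψ : Spinor)
    (F : Finset ℤ) :
    siteOp x M f (ψ, F) = inFrame ψ M (occ x F) (occ x F) * f (ψ, F) +
      inFrame ψ M (occ x F) (1 - occ x F) * f (ψ, F ∆ {x}) := rfl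

theorem frame_unitary (ψ : Spinor) : frame ψ * (frame ψ)ᴴ = 1 := by
  have h : ‖ψ.1‖ = 1 := by simp
  have h2 : ψ.1 0 * star (ψ.1 0) + ψ.1 1 * star (ψ.1 1) = 1 := by
    have := EuclideanSpace.norm_sq_eq ψ.1
    rw [h] at this
    simp [Fin.sum_univ_two] at this
    simp only [Complex.star_def, Complex.mul_conj']
    exact_mod_cast this.symm
  simp only [Complex.star_def] at h2
  ext i j
  fin_cases i <;> fin_cases j <;>
    simp [frame, Matrix.mul_apply, Fin.sum_univ_two] <;>
    first
      | linear_combination h2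
      | ring

theorem inFrame_mul (ψ : Spinor) (M N : Matrix (Fin 2) (Fin 2) ℂ) :
    inFrame ψ (M * N) = inFrame ψ M * inFrame ψ N := by
  simp only [inFrame]
  calc _ = (frame ψ)ᴴ * M * 1 * N * frame ψ := by simp [Matrix.mul_assoc]
    _ = _ := by rw [← frame_unitary ψ]; simp only [Matrix.mul_assoc]

theorem inFrame_star (ψ : Spinor) (M : Matrix (Fin 2) (Fin 2) ℂ) :
    inFrame ψ Mᴴ = (inFrame ψ M)ᴴ := by
  simp [inFrame, Matrix.mul_assoc]

theorem occ_flip (x : ℤ) (F : Finset ℤ) : occ x (F ∆ {x}) = 1 - occ x F := by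
  by_cases h : x ∈ F <;> simp [occ, Finset.mem_symmDiff, h]

theorem occ_flip_ne {x y : ℤ} (h : x ≠ y) (F : Finset ℤ) : occ x (F ∆ {y}) = occ x F := by
  by_cases h' : x ∈ F <;> simp [occ, Finset.mem_symmDiff, h', h]

/-- One-site observables at the same site multiply as matrices. -/
theorem siteOp_mul (x : ℤ) (M N : Matrix (Fin 2) (Fin 2) ℂ) :
    siteOp x (M * N) = siteOp x M * siteOp x N := by
  ext f ⟨ψ, F⟩
  simp only [mul_apply_eq_comp, siteOp_apply, inFrame_mul, occ_flip,
    Matrix.mul_apply, Fin.sum_univ_two, symmDiff_symmDiff_cancel_right]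
  rcases (by decide : ∀ a : Fin 2, a = 0 ∨ a = 1) (occ x F) with h | h <;> simp [h] <;> ring

/-- Observables at different sites commute. -/
theorem siteOp_commute {x y : ℤ} (h : x ≠ y) (M N : Matrix (Fin 2) (Fin 2) ℂ) :
    siteOp x M * siteOp y N = siteOp y N * siteOp x M := by
  ext f ⟨ψ, F⟩
  simp only [mul_apply_eq_comp, siteOp_apply, occ_flip_ne h, occ_flip_ne h.symm,
    symmDiff_right_comm F {x} {y}]
  ring

theorem siteOp_one (x : ℤ) : siteOp x 1 = 1 := by
  have h (ψ) : inFrame ψ 1 = 1 := by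
    simp [inFrame, mul_eq_one_comm.mp (frame_unitary ψ)]
  ext f ⟨ψ, F⟩
  simp only [siteOp_apply, h]
  rcases (by decide : ∀ a : Fin 2, a = 0 ∨ a = 1) (occ x F) with h | h <;> simp [h]

/-- The Hermitian conjugate of a one-site observable. -/
theorem siteOp_star (x : ℤ) (M : Matrix (Fin 2) (Fin 2) ℂ) :
    star (siteOp x M) = siteOp x Mᴴ := by
  rw [ContinuousLinearMap.star_eq_adjoint, eq_comm, ContinuousLinearMap.eq_adjoint_iff]
  intro f g
  rw [lp.inner_eq_tsum, lp.inner_eq_tsum]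
  set e : Equiv.Perm (Spinor × Finset ℤ) := Equiv.prodCongr (Equiv.refl Spinor) (flipEquiv x)
  have hs1 : Summable fun i : Spinor × Finset ℤ =>
      inner ℂ (inFrame i.1 Mᴴ (occ x i.2) (occ x i.2) * f i) (g i) :=
    lp.summable_inner (multOp (fun i : Spinor × Finset ℤ => inFrame i.1 Mᴴ (occ x i.2) (occ x i.2))
      ⟨_, fun i => inFrame_entry_le i.1 Mᴴ _ _⟩ f) g
  have hs2 : Summable fun i : Spinor × Finset ℤ =>
      inner ℂ (inFrame i.1 Mᴴ (occ x i.2) (1 - occ x i.2) * f (e i)) (g i) :=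
    lp.summable_inner (multOp (fun i : Spinor × Finset ℤ =>
      inFrame i.1 Mᴴ (occ x i.2) (1 - occ x i.2))
      ⟨_, fun i => inFrame_entry_le i.1 Mᴴ _ _⟩ (permOp e f)) g
  have ht1 : Summable fun i : Spinor × Finset ℤ =>
      inner ℂ (f i) (inFrame i.1 M (occ x i.2) (occ x i.2) * g i) :=
    lp.summable_inner f (multOp (fun i : Spinor × Finset ℤ => inFrame i.1 M (occ x i.2) (occ x i.2))
      ⟨_, fun i => inFrame_entry_le i.1 M _ _⟩ g)
  have ht2 : Summable fun i : Spinor × Finset ℤ =>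
      inner ℂ (f i) (inFrame i.1 M (occ x i.2) (1 - occ x i.2) * g (e i)) :=
    lp.summable_inner f (multOp (fun i : Spinor × Finset ℤ =>
      inFrame i.1 M (occ x i.2) (1 - occ x i.2))
      ⟨_, fun i => inFrame_entry_le i.1 M _ _⟩ (permOp e g))
  have hl : ∀ i : Spinor × Finset ℤ, inner ℂ (siteOp x Mᴴ f i) (g i) =
    inner ℂ (inFrame i.1 Mᴴ (occ x i.2) (occ x i.2) * f i) (g i) +
    inner ℂ (inFrame i.1 Mᴴ (occ x i.2) (1 - occ x i.2) * f (e i)) (g i) :=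
    fun i => inner_add_left _ _ _
  have hr : ∀ i : Spinor × Finset ℤ, inner ℂ (f i) (siteOp x M g i) =
    inner ℂ (f i) (inFrame i.1 M (occ x i.2) (occ x i.2) * g i) +
    inner ℂ (f i) (inFrame i.1 M (occ x i.2) (1 - occ x i.2) * g (e i)) :=
    fun i => inner_add_right _ _ _
  simp only [hl, hr]
  rw [hs1.tsum_add hs2, ht1.tsum_add ht2]
  congr 1
  · refine tsum_congr fun i => ?_
    simp [inFrame_star]
    ring
  · rw [← e.tsum_eq]
    refine tsum_congr fun i => ?_
    obtain ⟨ψ, F⟩ := i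
    have : e (e (ψ, F)) = (ψ, F) := by simp [e, flipEquiv]
    rw [this]
    simp [e, flipEquiv, occ_flip, inFrame_star]
    ring

/-- The spin algebra of the chain: the C*-algebra generated by all one-site observables. -/
def spinAlgebra : StarSubalgebra ℂ (ChainSpace →L[ℂ] ChainSpace) :=
  (StarAlgebra.adjoin ℂ
    (Set.range fun p : ℤ × Matrix (Fin 2) (Fin 2) ℂ => siteOp p.1 p.2)).topologicalClosure

/-- The one-site observable `M` at the site `x`, as an element of the spin algebra. -/
def site (x : ℤ) (M : Matrix (Fin 2) (Fin 2) ℂ) : spinAlgebra :=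
  ⟨siteOp x M, StarSubalgebra.le_topologicalClosure _
    (StarAlgebra.subset_adjoin ℂ _ ⟨(x, M), rfl⟩)⟩

/-- A state: a positive linear functional which is `1` at the unit. -/
def IsState (ω : spinAlgebra →ₗ[ℂ] ℂ) : Prop :=
  (∀ A : spinAlgebra, 0 ≤ ω (star A * A)) ∧ ω 1 = 1

/-- The functional `A ↦ (v, A v)`. -/
def vectorFunctional (v : ChainSpace) : spinAlgebra →ₗ[ℂ] ℂ where
  toFun A := inner ℂ v ((A : ChainSpace →L[ℂ] ChainSpace) v)
  map_add' A B := by simp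
  map_smul' c A := by simp

/-! ### Mean entropy -/

/-- The matrix unit `|η)(ξ|` of `⊗_{x ∈ Λ} ℂ²`, as an element of the spin algebra. -/
def matrixUnit (Λ : Finset ℤ) (η ξ : Λ → Fin 2) : spinAlgebra :=
  ((Finset.univ.sort (fun x y : Λ => x ≤ y)).map
    fun x : Λ => site x (Matrix.single (η x) (ξ x) (1 : ℂ))).prod

/-- The matrix `ω_Λ` with `ω(A) = Tr(ω_Λ A)` for all observables `A` of the region `Λ`. -/
def densityMatrix (ω : spinAlgebra →ₗ[ℂ] ℂ) (Λ : Finset ℤ) :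
    Matrix (Λ → Fin 2) (Λ → Fin 2) ℂ :=
  Matrix.of fun ξ η => ω (matrixUnit Λ η ξ)

/-- The entropy `S_Λ(ω) = -Tr(ω_Λ log ω_Λ)` (with `0 log 0 = 0`). -/
def entropy (ω : spinAlgebra →ₗ[ℂ] ℂ) (Λ : Finset ℤ) : ℝ :=
  (cfc Real.negMulLog (densityMatrix ω Λ)).trace.re

/-- The boxes of length `a`, which partition `ℤ` as `k` varies. -/
def box (a : ℕ) (k : ℤ) : Finset ℤ := Finset.Ico (k * a) ((k + 1) * a)

/-- The number of boxes of length `a` contained in `Λ`. -/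
def innerCount (a : ℕ) (Λ : Finset ℤ) : ℕ := {k : ℤ | box a k ⊆ Λ}.ncard

/-- The number of boxes of length `a` that meet `Λ`. -/
def outerCount (a : ℕ) (Λ : Finset ℤ) : ℕ := {k : ℤ | (box a k ∩ Λ).Nonempty}.ncard

/-- The filter of finite regions tending to infinity in the sense of van Hove: for every `a > 0`
the number of boxes of length `a` contained in `Λ` tends to infinity, and its ratio to the number
of boxes that meet `Λ` tends to `1`. -/
def vanHove : Filter (Finset ℤ) :=
  ⨅ a : ℕ, ⨅ _ : 0 < a,
    Filter.comap (innerCount a) Filter.atTop ⊓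
      Filter.comap (fun Λ => (outerCount a Λ : ℝ) / innerCount a Λ) (nhds 1)

theorem innerCount_range (a : ℕ) (ha : 0 < a) (N : ℕ) :
    innerCount a (Finset.Ico 0 (N : ℤ)) = N / a := by
  have h : {k : ℤ | box a k ⊆ Finset.Ico 0 (N : ℤ)} = ↑(Finset.Ico 0 ((N : ℤ) / a)) := by
    have ha' : (0 : ℤ) < a := by exact_mod_cast ha
    ext k
    have hlt : k * a < (k + 1) * a := by nlinarith
    simp only [box, Set.mem_ofPred_eq, Finset.coe_Ico, Set.mem_Ico]
    rw [Finset.Ico_subset_Ico_iff hlt, ← Int.add_one_le_iff (a := k), Int.le_ediv_iff_mul_le ha']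
    refine and_congr_left fun _ => ⟨fun h => ?_, fun h => by positivity⟩
    nlinarith
  rw [innerCount, h, Set.ncard_coe_finset, Int.card_Ico]
  simp
  norm_cast

theorem outerCount_range (a : ℕ) (ha : 0 < a) (N : ℕ) :
    N / a ≤ outerCount a (Finset.Ico 0 (N : ℤ)) ∧
      outerCount a (Finset.Ico 0 (N : ℤ)) ≤ N / a + 1 := by
  have ha' : (0 : ℤ) < a := by exact_mod_cast ha
  have hsub : {k : ℤ | (box a k ∩ Finset.Ico 0 (N : ℤ)).Nonempty} ⊆
      ↑(Finset.Ico 0 ((N : ℤ) / a + 1)) := by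
    rintro k ⟨x, hx⟩
    simp only [box, Finset.mem_inter, Finset.mem_Ico] at hx
    obtain ⟨⟨h1, h2⟩, h3, h4⟩ := hx
    simp only [Finset.coe_Ico, Set.mem_Ico, Int.lt_add_one_iff, Int.le_ediv_iff_mul_le ha']
    refine ⟨?_, by omega⟩
    by_contra hk
    nlinarith
  constructor
  · rw [← innerCount_range a ha N]
    refine Set.ncard_le_ncard (fun k hk => ?_) ((Finset.finite_toSet _).subset hsub)
    simp only [Set.mem_ofPred_eq] at hk ⊢
    rw [Finset.inter_eq_left.mpr hk]
    exact Finset.nonempty_Ico.mpr (by nlinarith)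
  · refine (Set.ncard_le_ncard hsub (Finset.finite_toSet _)).trans ?_
    rw [Set.ncard_coe_finset, Int.card_Ico]
    have : (N : ℤ) / a = ((N / a : ℕ) : ℤ) := by norm_cast
    rw [this]
    simp

/-- The intervals `{0, …, N - 1}` tend to infinity in the sense of van Hove. -/
theorem tendsto_Ico_vanHove :
    Filter.Tendsto (fun N : ℕ => Finset.Ico 0 (N : ℤ)) Filter.atTop vanHove := by
  simp only [vanHove, Filter.tendsto_iInf, Filter.tendsto_inf, Filter.tendsto_comap_iff]
  intro a ha
  have hin : Filter.Tendsto (fun N : ℕ => N / a) Filter.atTop Filter.atTop :=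
    Nat.tendsto_div_const_atTop ha.ne'
  have hin' : Filter.Tendsto (fun N : ℕ => ((N / a : ℕ) : ℝ)) Filter.atTop Filter.atTop :=
    tendsto_natCast_atTop_atTop.comp hin
  refine ⟨hin.congr fun N => (innerCount_range a ha N).symm, ?_⟩
  have hup : Filter.Tendsto (fun N : ℕ => 1 + ((N / a : ℕ) : ℝ)⁻¹) Filter.atTop (nhds 1) := by
    simpa using (tendsto_inv_atTop_zero.comp hin').const_add 1
  refine tendsto_of_tendsto_of_tendsto_of_le_of_le' tendsto_const_nhds hup ?_ ?_ <;>
  · filter_upwards [hin'.eventually_gt_atTop 0] with N hN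
    obtain ⟨h1, h2⟩ := outerCount_range a ha N
    have h1' : ((N / a : ℕ) : ℝ) ≤ outerCount a (Finset.Ico 0 (N : ℤ)) := by exact_mod_cast h1
    have h2' : (outerCount a (Finset.Ico 0 (N : ℤ)) : ℝ) ≤ ((N / a : ℕ) : ℝ) + 1 := by
      exact_mod_cast h2
    simp only [Function.comp, innerCount_range a ha N]
    first
    | (rw [le_div_iff₀ hN]; linarith)
    | (rw [div_le_iff₀ hN, add_mul, inv_mul_cancel₀ hN.ne']; linarith)

instance : vanHove.NeBot := tendsto_Ico_vanHove.neBot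

/-- The mean entropy of `ω` exists and equals `s`. -/
def HasMeanEntropy (ω : spinAlgebra →ₗ[ℂ] ℂ) (s : ℝ) : Prop :=
  Filter.Tendsto (fun Λ => entropy ω Λ / Λ.card) vanHove (nhds s)

/-- The mean entropy `s(ω) = lim S_Λ(ω) / |Λ|` in the sense of van Hove. -/
def meanEntropy (ω : spinAlgebra →ₗ[ℂ] ℂ) : ℝ :=
  Filter.limUnder vanHove fun Λ => entropy ω Λ / Λ.card

/-! ### The measurement model -/

/-- `σ · n` for the vector `σ` of Pauli matrices. -/
def sigmaDot (n : EuclideanSpace ℝ (Fin 3)) : Matrix (Fin 2) (Fin 2) ℂ :=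
  (n 0 : ℂ) • !![0, 1; 1, 0] + (n 1 : ℂ) • !![0, -Complex.I; Complex.I, 0] +
    (n 2 : ℂ) • !![1, 0; 0, -1]

/-- The product vector `⊗_x ψ` over all sites. -/
def productVector (ψ : Spinor) : ChainSpace := lp.single 2 (ψ, ∅) 1

/-- The expectation of a one-site observable in the product state given by `ψ` is `(ψ, M ψ)`. -/
theorem productVector_site (ψ : Spinor) (x : ℤ) (M : Matrix (Fin 2) (Fin 2) ℂ) :
    vectorFunctional (productVector ψ) (site x M) =
      inner ℂ ψ.1 (WithLp.toLp 2 (M.mulVec ψ.1.ofLp)) := by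
  simp only [vectorFunctional, productVector, LinearMap.coe_mk, AddHom.coe_mk, site]
  rw [lp.inner_single_left, siteOp_apply]
  simp [occ, inFrame, frame, Matrix.mul_apply, Fin.sum_univ_two, PiLp.inner_apply,
    Finset.singleton_ne_empty]
  ring

/-- The projection `P_k = (1 + σ_k · s) / 2`. -/
def spinProj (s : EuclideanSpace ℝ (Fin 3)) (k : ℤ) : spinAlgebra :=
  site k ((1 / 2 : ℂ) • (1 + sigmaDot s))

/-- The history projection `P_α`: the product over the sites `1, …, n` of `P_i` where `α_i = 0` and
of `1 - P_i` where `α_i = 1`. -/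
def historyProj (s : EuclideanSpace ℝ (Fin 3)) {n : ℕ} (α : Fin n → Fin 2) : spinAlgebra :=
  (List.ofFn fun i : Fin n =>
    if α i = 0 then spinProj s ((i : ℤ) + 1) else 1 - spinProj s ((i : ℤ) + 1)).prod

/-- The Hilbert space of system and apparatus.  The apparatus space is the incomplete tensor product
of the pointer spaces `ℂ²` along the vector with all pointers down; its orthonormal basis vector with
index `F` has the pointers in `F` up and all the others down. -/
abbrev JointSpace : Type := LTwo (Finset ℤ) ChainSpace

/-- `A ⊗ 1`. -/
def onSystem (A : ChainSpace →L[ℂ] ChainSpace) : JointSpace →L[ℂ] JointSpace :=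
  diagOp (fun _ => A) ⟨‖A‖, fun _ => le_rfl⟩

/-- `1 ⊗ τ_k`, which turns the pointer `k`. -/
def turnPointer (k : ℤ) : JointSpace →L[ℂ] JointSpace := permOp (flipEquiv k)

/-- The measurement of the spin `k`: `V_k = P_k ⊗ 1 + (1 - P_k) ⊗ τ_k`. -/
def measure (s : EuclideanSpace ℝ (Fin 3)) (k : ℤ) : JointSpace →L[ℂ] JointSpace :=
  onSystem (spinProj s k) + onSystem (1 - spinProj s k) ∘L turnPointer k

/-- The time evolution `U` between measurements: the shift by one unit, of spins and pointers. -/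
def shift : JointSpace →L[ℂ] JointSpace :=
  onSystem (permOp (Equiv.prodCongr (Equiv.refl Spinor) translateEquiv)) ∘L
    permOp translateEquiv

/-- The initial vector `(√μ ⊗_x ψ ⊕ √(1-μ) ⊗_x φ) ⊗ |all pointers down)`. -/
def initialVector (μ : ℝ) (ψ φ : Spinor) : JointSpace :=
  lp.single 2 ∅ (((√μ : ℝ) : ℂ) • productVector ψ + ((√(1 - μ) : ℝ) : ℂ) • productVector φ)

/-- The vector `|Ω(n)) = (V_1 U)^n |Ω)` after `n` time units. -/
def finalVector (s : EuclideanSpace ℝ (Fin 3)) (μ : ℝ) (ψ φ : Spinor) (n : ℕ) : JointSpace :=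
  ((measure s 1 ∘L shift) ^ n) (initialVector μ ψ φ)

/-- The set of pointers that are up in the history `α`. -/
def pointers {n : ℕ} (α : Fin n → Fin 2) : Finset ℤ :=
  (Finset.univ.filter fun i => α i = 1).image fun i : Fin n => (i : ℤ) + 1

/-- The component `v(α)` of `|Ω(n))` along the pointer position `α`. -/
def historyVector (s : EuclideanSpace ℝ (Fin 3)) (μ : ℝ) (ψ φ : Spinor) {n : ℕ}
    (α : Fin n → Fin 2) : ChainSpace :=
  finalVector s μ ψ φ n (pointers α)

/-- The probability `W(α) = ‖v(α)‖²` of the history `α`. -/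
def historyProb (s : EuclideanSpace ℝ (Fin 3)) (μ : ℝ) (ψ φ : Spinor) {n : ℕ}
    (α : Fin n → Fin 2) : ℝ :=
  ‖historyVector s μ ψ φ α‖ ^ 2

/-- The state of the system after reading the pointers in the position `α`:
`A ↦ (v(α), A v(α)) / W(α)`. -/
def collapsed (s : EuclideanSpace ℝ (Fin 3)) (μ : ℝ) (ψ φ : Spinor) {n : ℕ}
    (α : Fin n → Fin 2) : spinAlgebra →ₗ[ℂ] ℂ :=
  ((historyProb s μ ψ φ α : ℂ)⁻¹) • vectorFunctional (historyVector s μ ψ φ α)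

/-- The mixture `μ ω₁ + (1 - μ) ω₂` of the product states given by `ψ` and `φ`. -/
def mixture (μ : ℝ) (ψ φ : Spinor) : spinAlgebra →ₗ[ℂ] ℂ :=
  (μ : ℂ) • vectorFunctional (productVector ψ) +
    ((1 - μ : ℝ) : ℂ) • vectorFunctional (productVector φ)

end SpinChain

end

open scoped ComplexOrder Matrix symmDiff

noncomputable section

namespace SpinChain

/-! ### Product vectors -/

/-! The averaged identity holds because both sides are zero: the mixture and every collapsed state
have local entropies in `[0, 2]`, whatever the region, while `|Λ|` tends to infinity along
`vanHove`. No comparison of entropies before and after the measurement is needed.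

The bound is a statement about rank. One-site observables act factorwise on product vectors
(`siteOp_productFun`, `list_prod_site_productFun`), so a history projection turns a product vector
into another, unnormalized, product vector. Its reduced matrix on `Λ` has the form `b b*`
(`exists_vectorFunctional_matrixUnit`). A projected mixture of two product states therefore has a
density matrix of rank at most 2 (`entropy_mem_Icc`), and the entropy is at most the rank because
`-x log x ≤ 1` for every `x > 0`.

To apply this to the dynamics, `historyVector_eq` identifies `v(α)` with the history projection
applied to the initial system vector: each shift moves the earlier outcomes one site to the right
and frees site 1 for the new one. The vector state of the superposition equals the mixture because
the sector projections commute with the whole algebra and so remove the interference terms; this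
needs `ψ ≠ φ`, which follows from `n ≠ m` through `(σ · a)² = |a|²`. -/

open Classical in
/-- The coefficients of the vector `⊗_{x ∈ T} w x ⊗ ⊗_{x ∉ T} ψ`. -/
def productFun (ψ : Spinor) (T : Finset ℤ) (w : ℤ → Fin 2 → ℂ) (i : Spinor × Finset ℤ) : ℂ :=
  if i.1 = ψ ∧ i.2 ⊆ T then ∏ x ∈ T, ((frame ψ)ᴴ *ᵥ w x) (occ x i.2) else 0

/-- Passing to coordinates in the frame intertwines the two actions of `M`, since the frame is
unitary. -/
theorem inFrame_mulVec (ψ : Spinor) (M : Matrix (Fin 2) (Fin 2) ℂ) (w : Fin 2 → ℂ) :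
    inFrame ψ M *ᵥ ((frame ψ)ᴴ *ᵥ w) = (frame ψ)ᴴ *ᵥ (M *ᵥ w) := by
  simp only [inFrame, Matrix.mulVec_mulVec, Matrix.mul_assoc, frame_unitary, Matrix.mul_one]

theorem symmDiff_singleton_subset {T : Finset ℤ} {y : ℤ} (hy : y ∈ T) (F : Finset ℤ) :
    F ∆ {y} ⊆ T ↔ F ⊆ T := by
  constructor
  · intro h x hx
    by_cases hxy : x = y
    · rwa [hxy]
    · exact h (by simp [Finset.mem_symmDiff, hx, hxy])
  · intro h x hx
    rcases Finset.mem_symmDiff.mp hx with h' | h'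
    · exact h h'.1
    · rwa [Finset.mem_singleton.mp h'.1]

/-- The diagonal and the flip term of `siteOp` are the two summands of a matrix-vector product at
`y`; the factors at the other sites do not see the flip. Since `y ∈ T`, the flip also preserves the
support condition. -/
theorem siteOp_productFun {ψ : Spinor} {T : Finset ℤ} {w : ℤ → Fin 2 → ℂ} {f : ChainSpace}
    (hf : ⇑f = productFun ψ T w) {y : ℤ} (hy : y ∈ T) (M : Matrix (Fin 2) (Fin 2) ℂ) :
    ⇑(siteOp y M f) = productFun ψ T (Function.update w y (M *ᵥ w y)) := by
  funext ⟨ψ', F⟩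
  rw [siteOp_apply, hf]
  by_cases h : ψ' = ψ ∧ F ⊆ T
  · obtain ⟨rfl, hF⟩ := h
    have hF' := (symmDiff_singleton_subset hy F).mpr hF
    simp only [productFun, hF, hF', and_self, if_true]
    -- Isolates the factor at `y`. It serves for the original configuration, the flipped one, and
    -- the updated vector, all sharing the same product over the remaining sites.
    have key : ∀ G : Finset ℤ, (∀ x ≠ y, occ x G = occ x F) → ∀ w' : ℤ → Fin 2 → ℂ,
        (∀ x ≠ y, w' x = w x) →
        ∏ x ∈ T, ((frame ψ')ᴴ *ᵥ w' x) (occ x G) = ((frame ψ')ᴴ *ᵥ w' y) (occ y G) *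
          ∏ x ∈ T.erase y, ((frame ψ')ᴴ *ᵥ w x) (occ x F) := by
      intro G hG w' hw'
      rw [← Finset.mul_prod_erase T _ hy]
      congr 1
      refine Finset.prod_congr rfl fun x hx => ?_
      rw [hG x (Finset.ne_of_mem_erase hx), hw' x (Finset.ne_of_mem_erase hx)]
    rw [key F (fun _ _ => rfl) w (fun _ _ => rfl),
      key (F ∆ {y}) (fun x hx => occ_flip_ne hx F) w (fun _ _ => rfl),
      key F (fun _ _ => rfl) _ (fun x hx => Function.update_of_ne hx _ _), Function.update_self,
      ← inFrame_mulVec, occ_flip]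
    conv_rhs => rw [Matrix.mulVec, dotProduct, Fin.sum_univ_two]
    rcases (by decide : ∀ a : Fin 2, a = 0 ∨ a = 1) (occ y F) with h | h <;> simp [h] <;> ring
  · have h' : ¬ (ψ' = ψ ∧ F ∆ {y} ⊆ T) := by rwa [symmDiff_singleton_subset hy]
    simp only [productFun, h, h', if_false, mul_zero, add_zero]

theorem frame_conjTranspose_mulVec_self (ψ : Spinor) (a : Fin 2) :
    ((frame ψ)ᴴ *ᵥ ψ.1.ofLp) a = if a = 0 then 1 else 0 := by
  have h : ψ.1.ofLp = frame ψ *ᵥ ![1, 0] := by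
    ext i; fin_cases i <;> simp [frame, Matrix.mulVec, dotProduct]
  rw [h, Matrix.mulVec_mulVec, mul_eq_one_comm.mp (frame_unitary ψ), Matrix.one_mulVec]
  fin_cases a <;> simp

/-- In its own frame `ψ` has coordinates `(1, 0)`, so any excited site kills the product. This is
why `T` is arbitrary and can be chosen to contain all sites acted upon later. -/
theorem productVector_eq_productFun (ψ : Spinor) (T : Finset ℤ) :
    ⇑(productVector ψ) = productFun ψ T fun _ => ψ.1.ofLp := by
  classical
  funext ⟨ψ', F⟩
  simp only [productVector, productFun, frame_conjTranspose_mulVec_self, lp.coeFn_single]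
  by_cases hψ : ψ' = ψ
  · subst hψ
    by_cases hF : F = ∅
    · subst hF
      simp [occ]
    · obtain ⟨x, hx⟩ := Finset.nonempty_iff_ne_empty.mpr hF
      rw [Pi.single_eq_of_ne (by simpa using hF)]
      split_ifs with h
      · rw [eq_comm]
        exact Finset.prod_eq_zero (h.2 hx) (by simp [occ, hx])
      · rfl
  · rw [Pi.single_eq_of_ne (by simp [hψ])]
    simp [hψ]

/-- A product of one-site observables at distinct sites acts factorwise on product vectors. -/
theorem list_prod_site_productFun {ι : Type*} {g : ι → ℤ} (hg : Function.Injective g)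
    (m : ι → Matrix (Fin 2) (Fin 2) ℂ) {ψ : Spinor} {T : Finset ℤ} {w : ℤ → Fin 2 → ℂ}
    {f : ChainSpace} (hf : ⇑f = productFun ψ T w) :
    ∀ (l : List ι) (_ : l.Nodup) (_ : ∀ i ∈ l, g i ∈ T) (w' : ℤ → Fin 2 → ℂ)
      (_ : ∀ i ∈ l, w' (g i) = m i *ᵥ w (g i)) (_ : ∀ x, (∀ i ∈ l, g i ≠ x) → w' x = w x),
      ⇑(((l.map fun i => site (g i) (m i)).prod : ChainSpace →L[ℂ] ChainSpace) f) =
        productFun ψ T w'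
  | [], _, _, w', _, h2 => by
    have : w' = w := funext fun x => h2 x (by simp)
    simpa [this] using hf
  | i :: l, hl, hT, w', h1, h2 => by
    have hi : ∀ j ∈ l, g j ≠ g i := fun j hj h => (List.nodup_cons.mp hl).1 (hg h ▸ hj)
    -- The tail of the list leaves the site `g i` alone, so the induction hypothesis is taken with
    -- the original factor restored there; the head then acts on it.
    have ih := list_prod_site_productFun hg m hf l (List.nodup_cons.mp hl).2
      (fun j hj => hT j (List.mem_cons_of_mem _ hj)) (Function.update w' (g i) (w (g i)))
      (fun j hj => by rw [Function.update_of_ne (hi j hj), h1 j (List.mem_cons_of_mem _ hj)])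
      (fun x hx => by
        by_cases hxi : x = g i
        · rw [hxi, Function.update_self]
        · rw [Function.update_of_ne hxi]
          refine h2 x fun j hj => ?_
          rcases List.mem_cons.mp hj with rfl | hj
          · exact Ne.symm hxi
          · exact hx j hj)
    have := siteOp_productFun ih (hT i List.mem_cons_self) (m i)
    rw [Function.update_self, Function.update_idem, ← h1 i List.mem_cons_self,
      Function.update_eq_self] at this
    simpa [site] using this

theorem inner_productVector (ψ : Spinor) (f : ChainSpace) :
    inner ℂ (productVector ψ) f = f (ψ, ∅) := by
  rw [productVector, lp.inner_single_left]
  simp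

theorem frame_conjTranspose_mulVec_zero (ψ : Spinor) (w : Fin 2 → ℂ) :
    ((frame ψ)ᴴ *ᵥ w) 0 = star ψ.1.ofLp ⬝ᵥ w := by
  simp [frame, Matrix.mulVec, dotProduct, Fin.sum_univ_two]

theorem inner_productVector_of_eq_productFun {ψ : Spinor} {T : Finset ℤ} {w : ℤ → Fin 2 → ℂ}
    {f : ChainSpace} (hf : ⇑f = productFun ψ T w) :
    inner ℂ (productVector ψ) f = ∏ x ∈ T, star ψ.1.ofLp ⬝ᵥ w x := by
  rw [inner_productVector, hf]
  simp [productFun, occ, frame_conjTranspose_mulVec_zero]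

/-! ### Sectors -/

open Classical in
/-- The projection onto the sector with the reference vector `ψ`. -/
def sectorProj (ψ : Spinor) : ChainSpace →L[ℂ] ChainSpace :=
  multOp (fun i => if i.1 = ψ then 1 else 0) ⟨1, fun i => by split_ifs <;> simp⟩

open Classical in
theorem sectorProj_apply (ψ : Spinor) (f : ChainSpace) (i : Spinor × Finset ℤ) :
    sectorProj ψ f i = (if i.1 = ψ then 1 else 0) * f i := rfl

theorem siteOp_sectorProj (ψ : Spinor) (x : ℤ) (M : Matrix (Fin 2) (Fin 2) ℂ) :
    sectorProj ψ * siteOp x M = siteOp x M * sectorProj ψ := by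
  ext f ⟨ψ', F⟩
  simp only [mul_apply_eq_comp, siteOp_apply, sectorProj_apply]
  ring

/-- The centralizer of a set is a norm-closed star subalgebra, so commutation need only be checked
on the generators; the relation for the adjoint comes from the one for `Mᴴ`. -/
theorem sectorProj_commute (ψ : Spinor) (A : spinAlgebra) :
    sectorProj ψ * (A : ChainSpace →L[ℂ] ChainSpace) = A * sectorProj ψ := by
  have h : spinAlgebra ≤ StarSubalgebra.centralizer ℂ {sectorProj ψ} := by
    refine StarSubalgebra.topologicalClosure_minimal (StarAlgebra.adjoin_le ?_)
      (Set.isClosed_centralizer _)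
    rintro _ ⟨⟨x, M⟩, rfl⟩
    refine (StarSubalgebra.mem_centralizer_iff ℂ).mpr ?_
    rintro _ rfl
    refine ⟨siteOp_sectorProj ψ x M, ?_⟩
    have := congrArg star (siteOp_sectorProj ψ x Mᴴ)
    simpa [siteOp_star] using this.symm
  exact ((StarSubalgebra.mem_centralizer_iff ℂ).mp (h A.2) _ rfl).1

theorem sectorProj_productVector (ψ : Spinor) :
    sectorProj ψ (productVector ψ) = productVector ψ := by
  classical
  ext ⟨ψ', F⟩
  rw [sectorProj_apply, productVector_eq_productFun ψ ∅]
  by_cases h : ψ' = ψ <;> simp [productFun, h]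

/-- Disjointness of the two product states: an observable keeps the `φ` sector invariant, and the
`ψ` product vector lies in another sector. -/
theorem inner_productVector_apply_of_ne {ψ φ : Spinor} (h : ψ ≠ φ) (A : spinAlgebra) :
    inner ℂ (productVector ψ) ((A : ChainSpace →L[ℂ] ChainSpace) (productVector φ)) = 0 := by
  have := congrArg (fun T : ChainSpace →L[ℂ] ChainSpace => T (productVector φ) (ψ, ∅))
    (sectorProj_commute φ A)
  simp only [mul_apply_eq_comp, sectorProj_productVector, sectorProj_apply] at this
  rw [inner_productVector, ← this, if_neg h, zero_mul]

theorem norm_productVector (ψ : Spinor) : ‖productVector ψ‖ = 1 := by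
  simp [productVector]

/-- The vector `√μ ⊗_x ψ ⊕ √(1-μ) ⊗_x φ` of the system. -/
def systemVector (μ : ℝ) (ψ φ : Spinor) : ChainSpace :=
  ((√μ : ℝ) : ℂ) • productVector ψ + ((√(1 - μ) : ℝ) : ℂ) • productVector φ

theorem vectorFunctional_systemVector {ψ φ : Spinor} (h : ψ ≠ φ) {μ : ℝ} (h0 : 0 ≤ μ)
    (h1 : μ ≤ 1) : vectorFunctional (systemVector μ ψ φ) = mixture μ ψ φ := by
  ext A
  have e0 : ((√μ : ℝ) : ℂ) * ((√μ : ℝ) : ℂ) = μ := by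
    exact_mod_cast Real.mul_self_sqrt h0
  have e1 : ((√(1 - μ) : ℝ) : ℂ) * ((√(1 - μ) : ℝ) : ℂ) = ((1 - μ : ℝ) : ℂ) := by
    exact_mod_cast Real.mul_self_sqrt (sub_nonneg.mpr h1)
  simp only [vectorFunctional, systemVector, mixture, LinearMap.coe_mk, AddHom.coe_mk,
    LinearMap.add_apply, LinearMap.smul_apply, map_add, map_smul, inner_add_left,
    inner_add_right, inner_smul_left, inner_smul_right, Complex.conj_ofReal,
    inner_productVector_apply_of_ne h, inner_productVector_apply_of_ne h.symm, smul_eq_mul,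
    ← e0, ← e1]
  ring

theorem vectorFunctional_star_mul_self (v : ChainSpace) (A : spinAlgebra) :
    vectorFunctional v (star A * A) =
      ((‖(A : ChainSpace →L[ℂ] ChainSpace) v‖ ^ 2 : ℝ) : ℂ) := by
  simp only [vectorFunctional, LinearMap.coe_mk, AddHom.coe_mk, MulMemClass.coe_mul,
    StarMemClass.coe_star, mul_apply_eq_comp, ContinuousLinearMap.star_eq_adjoint,
    ContinuousLinearMap.adjoint_inner_right]
  rw [inner_self_eq_norm_sq_to_K]
  simp

theorem vectorFunctional_apply_vector (v : ChainSpace) (A B : spinAlgebra) :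
    vectorFunctional ((B : ChainSpace →L[ℂ] ChainSpace) v) A =
      vectorFunctional v (star B * A * B) := by
  simp only [vectorFunctional, LinearMap.coe_mk, AddHom.coe_mk, MulMemClass.coe_mul,
    StarMemClass.coe_star, mul_apply_eq_comp, ContinuousLinearMap.star_eq_adjoint,
    ContinuousLinearMap.adjoint_inner_right]

theorem vectorFunctional_one (v : ChainSpace) :
    vectorFunctional v 1 = ((‖v‖ ^ 2 : ℝ) : ℂ) := by
  simpa using vectorFunctional_star_mul_self v 1

theorem mixture_isState (ψ φ : Spinor) {μ : ℝ} (h0 : 0 ≤ μ) (h1 : μ ≤ 1) :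
    IsState (mixture μ ψ φ) := by
  constructor
  · intro A
    simp only [mixture, LinearMap.add_apply, LinearMap.smul_apply, smul_eq_mul,
      vectorFunctional_star_mul_self]
    norm_cast
    have := sub_nonneg.mpr h1
    positivity
  · simp [mixture, vectorFunctional_one, norm_productVector]

/-! ### History projections -/

theorem site_sub (x : ℤ) (M M' : Matrix (Fin 2) (Fin 2) ℂ) :
    site x (M - M') = site x M - site x M' := by
  refine Subtype.ext ?_
  change siteOp x (M - M') = siteOp x M - siteOp x M'
  ext f ⟨ψ, F⟩
  have h : inFrame ψ (M - M') = inFrame ψ M - inFrame ψ M' := by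
    simp [inFrame, Matrix.mul_sub, Matrix.sub_mul]
  change siteOp x (M - M') f (ψ, F) = siteOp x M f (ψ, F) - siteOp x M' f (ψ, F)
  simp only [siteOp_apply, h, Matrix.sub_apply]
  ring

theorem site_one (x : ℤ) : site x 1 = 1 := Subtype.ext (siteOp_one x)

theorem site_mul (x : ℤ) (M M' : Matrix (Fin 2) (Fin 2) ℂ) :
    site x (M * M') = site x M * site x M' := Subtype.ext (siteOp_mul x M M')

theorem site_star (x : ℤ) (M : Matrix (Fin 2) (Fin 2) ℂ) : star (site x M) = site x Mᴴ :=
  Subtype.ext (siteOp_star x M)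

theorem site_commute {x y : ℤ} (h : x ≠ y) (M M' : Matrix (Fin 2) (Fin 2) ℂ) :
    Commute (site x M) (site y M') := Subtype.ext (siteOp_commute h M M')

/-- The one-site projection of the outcome `a`: `(1 + σ · s) / 2` for `a = 0` and
`1 - (1 + σ · s) / 2` for `a = 1`. -/
def outcome (s : EuclideanSpace ℝ (Fin 3)) (a : Fin 2) : Matrix (Fin 2) (Fin 2) ℂ :=
  if a = 0 then (1 / 2 : ℂ) • (1 + sigmaDot s) else 1 - (1 / 2 : ℂ) • (1 + sigmaDot s)

theorem sigmaDot_isHermitian (s : EuclideanSpace ℝ (Fin 3)) : (sigmaDot s).IsHermitian := by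
  ext i j
  fin_cases i <;> fin_cases j <;> simp [sigmaDot]

/-- Used twice: for unit `s` it makes the outcomes projections, and for a difference of directions
it shows that distinct directions cannot share a spin-up vector. -/
theorem sigmaDot_mul_self (s : EuclideanSpace ℝ (Fin 3)) :
    sigmaDot s * sigmaDot s = ((‖s‖ ^ 2 : ℝ) : ℂ) • 1 := by
  rw [EuclideanSpace.norm_sq_eq]
  ext i j
  fin_cases i <;> fin_cases j <;>
    simp [sigmaDot, Matrix.mul_apply, Fin.sum_univ_two, Fin.sum_univ_three] <;>
    ring_nf <;> simp

theorem outcome_conjTranspose (s : EuclideanSpace ℝ (Fin 3)) (a : Fin 2) :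
    (outcome s a)ᴴ = outcome s a := by
  have h := (sigmaDot_isHermitian s).eq
  unfold outcome
  split_ifs <;> simp [h]

theorem outcome_mul_self {s : EuclideanSpace ℝ (Fin 3)} (hs : ‖s‖ = 1) (a : Fin 2) :
    outcome s a * outcome s a = outcome s a := by
  have h := sigmaDot_mul_self s
  rw [hs] at h
  have hp : IsIdempotentElem ((1 / 2 : ℂ) • (1 + sigmaDot s)) := by
    rw [IsIdempotentElem, smul_mul_smul_comm, add_mul, mul_add, mul_add, h]
    simp only [one_mul, mul_one, one_pow, Complex.ofReal_one, one_smul]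
    module
  unfold outcome
  split_ifs
  · exact hp
  · exact hp.one_sub

theorem historyProj_eq (s : EuclideanSpace ℝ (Fin 3)) {n : ℕ} (α : Fin n → Fin 2) :
    historyProj s α = ((List.finRange n).map fun i : Fin n =>
      site ((i : ℤ) + 1) (outcome s (α i))).prod := by
  rw [historyProj, List.ofFn_eq_map]
  congr 2
  funext i
  unfold outcome spinProj
  split_ifs
  · rfl
  · rw [site_sub, site_one]

theorem isStarProjection_list_prod {R : Type*} [Semiring R] [StarRing R] :
    ∀ (l : List R) (_ : ∀ x ∈ l, IsStarProjection x) (_ : l.Pairwise Commute),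
      IsStarProjection l.prod
  | [], _, _ => by simp
  | x :: l, h, hc => by
    rw [List.prod_cons]
    rw [List.pairwise_cons] at hc
    exact (h x List.mem_cons_self).mul
      (isStarProjection_list_prod l (fun y hy => h y (List.mem_cons_of_mem _ hy)) hc.2)
      (Commute.list_prod_right _ _ hc.1)

theorem siteIndex_injective (n : ℕ) : Function.Injective fun i : Fin n => (i : ℤ) + 1 :=
  fun i j h => Fin.ext (by simpa using h)

theorem historyProj_isStarProjection {s : EuclideanSpace ℝ (Fin 3)} (hs : ‖s‖ = 1) {n : ℕ}
    (α : Fin n → Fin 2) : IsStarProjection (historyProj s α) := by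
  rw [historyProj_eq]
  apply isStarProjection_list_prod
  · intro x hx
    obtain ⟨i, -, rfl⟩ := List.mem_map.mp hx
    exact isStarProjection_iff'.mpr
      ⟨by rw [← site_mul, outcome_mul_self hs], by rw [site_star, outcome_conjTranspose]⟩
  · exact List.pairwise_map.mpr ((List.nodup_finRange n).imp fun hij =>
      site_commute (fun h => hij (siteIndex_injective n h)) _ _)

/-- The one-site projection at the site `x` in the history `α`; it is `1` at unmeasured sites. -/
def outcomeAt (s : EuclideanSpace ℝ (Fin 3)) {n : ℕ} (α : Fin n → Fin 2) :
    ℤ → Matrix (Fin 2) (Fin 2) ℂ :=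
  Function.extend (fun i : Fin n => (i : ℤ) + 1) (fun i => outcome s (α i)) fun _ => 1

theorem outcomeAt_conjTranspose (s : EuclideanSpace ℝ (Fin 3)) {n : ℕ} (α : Fin n → Fin 2)
    (x : ℤ) : (outcomeAt s α x)ᴴ = outcomeAt s α x := by
  by_cases h : ∃ i : Fin n, (i : ℤ) + 1 = x
  · obtain ⟨i, rfl⟩ := h
    rw [outcomeAt, (siteIndex_injective n).extend_apply, outcome_conjTranspose]
  · rw [outcomeAt, Function.extend_apply' _ _ _ h, Matrix.conjTranspose_one]

theorem historyProj_productFun (s : EuclideanSpace ℝ (Fin 3)) {n : ℕ} (α : Fin n → Fin 2)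
    {ψ : Spinor} {T : Finset ℤ} (hT : ∀ i : Fin n, (i : ℤ) + 1 ∈ T) {w : ℤ → Fin 2 → ℂ}
    {f : ChainSpace} (hf : ⇑f = productFun ψ T w) :
    ⇑((historyProj s α : ChainSpace →L[ℂ] ChainSpace) f) =
      productFun ψ T fun x => outcomeAt s α x *ᵥ w x := by
  rw [historyProj_eq]
  refine list_prod_site_productFun (siteIndex_injective n) (fun i => outcome s (α i)) hf _
    (List.nodup_finRange n) (fun i _ => hT i) _ (fun i _ => ?_) (fun x hx => ?_)
  · rw [outcomeAt, (siteIndex_injective n).extend_apply]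
  · have : ¬ ∃ i : Fin n, (i : ℤ) + 1 = x := fun ⟨i, hi⟩ => hx i (List.mem_finRange i) hi
    rw [outcomeAt, Function.extend_apply' _ _ _ this, Matrix.one_mulVec]

/-- Stated for any `A` acting factorwise through `e`, so that it covers both matrix units and the
identity. Each left-hand outcome is moved into the bra by self-adjointness. -/
theorem vectorFunctional_historyProj (s : EuclideanSpace ℝ (Fin 3)) {n : ℕ} (α : Fin n → Fin 2)
    (ψ : Spinor) {T : Finset ℤ} (hT : ∀ i : Fin n, (i : ℤ) + 1 ∈ T) (A : spinAlgebra)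
    (e : ℤ → Matrix (Fin 2) (Fin 2) ℂ)
    (hA : ∀ (w : ℤ → Fin 2 → ℂ) (f : ChainSpace), ⇑f = productFun ψ T w →
      ⇑((A : ChainSpace →L[ℂ] ChainSpace) f) = productFun ψ T fun x => e x *ᵥ w x) :
    vectorFunctional (productVector ψ) (historyProj s α * A * historyProj s α) =
      ∏ x ∈ T, star (outcomeAt s α x *ᵥ ψ.1.ofLp) ⬝ᵥ
        (e x *ᵥ (outcomeAt s α x *ᵥ ψ.1.ofLp)) := by
  have h := historyProj_productFun s α hT (hA _ _
    (historyProj_productFun s α hT (productVector_eq_productFun ψ T)))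
  simp only [vectorFunctional, LinearMap.coe_mk, AddHom.coe_mk, MulMemClass.coe_mul,
    mul_apply_eq_comp]
  rw [inner_productVector_of_eq_productFun h]
  refine Finset.prod_congr rfl fun x _ => ?_
  rw [Matrix.star_mulVec, ← Matrix.dotProduct_mulVec, outcomeAt_conjTranspose]

/-! ### Entropy of matrices of bounded rank -/

theorem trace_cfc_negMulLog {n : Type*} [Fintype n] [DecidableEq n] {ρ : Matrix n n ℂ}
    (hρ : ρ.IsHermitian) :
    (cfc Real.negMulLog ρ).trace.re = ∑ i, Real.negMulLog (hρ.eigenvalues i) := by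
  rw [hρ.cfc_eq, Matrix.IsHermitian.cfc, Unitary.conjStarAlgAut_apply, Matrix.trace_mul_cycle]
  simp [Matrix.trace_diagonal]

/-- The entropy of a density matrix lies between `0` and its rank. -/
theorem trace_cfc_negMulLog_mem_Icc {n : Type*} [Fintype n] [DecidableEq n] {ρ : Matrix n n ℂ}
    (hρ : ρ.PosSemidef) (htr : ρ.trace = 1) :
    (cfc Real.negMulLog ρ).trace.re ∈ Set.Icc (0 : ℝ) ρ.rank := by
  rw [trace_cfc_negMulLog hρ.1]
  have hsum : ∑ i, hρ.1.eigenvalues i = 1 := by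
    have := hρ.1.trace_eq_sum_eigenvalues
    rw [htr] at this
    simpa using congrArg Complex.re this.symm
  have hle : ∀ i, hρ.1.eigenvalues i ≤ 1 := fun i => hsum ▸
    Finset.single_le_sum (fun j _ => hρ.eigenvalues_nonneg j) (Finset.mem_univ i)
  refine ⟨Finset.sum_nonneg fun i _ => Real.negMulLog_nonneg (hρ.eigenvalues_nonneg i) (hle i), ?_⟩
  rw [hρ.1.rank_eq_card_non_zero_eigs, Fintype.card_subtype, Finset.card_eq_sum_ones,
    Finset.sum_filter]
  push_cast
  refine Finset.sum_le_sum fun i _ => ?_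
  split_ifs with h
  · have hpos := lt_of_le_of_ne (hρ.eigenvalues_nonneg i) (Ne.symm h)
    -- From `1 - 1/x ≤ log x`, multiplied by `x`: `-x log x ≤ 1 - x ≤ 1`.
    have := mul_le_mul_of_nonneg_left (Real.one_sub_inv_le_log_of_pos hpos) hpos.le
    rw [mul_sub, mul_inv_cancel₀ h] at this
    simp only [Real.negMulLog]
    linarith
  · rw [not_not.mp h, Real.negMulLog_zero]

/-! ### Bounded entropies in the van Hove limit -/

theorem innerCount_one (Λ : Finset ℤ) : innerCount 1 Λ = Λ.card := by
  have : {k : ℤ | box 1 k ⊆ Λ} = ↑Λ := by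
    ext k
    have : box 1 k = {k} := by
      ext x
      simp [box]
      omega
    simp [this]
  rw [innerCount, this, Set.ncard_coe_finset]

/-- Boxes of length 1 are single sites, so the case `a = 1` of the van Hove condition already forces
the cardinality to infinity. -/
theorem tendsto_card_vanHove : Filter.Tendsto Finset.card vanHove Filter.atTop := by
  refine Filter.Tendsto.mono_left ?_ (iInf₂_le_of_le 1 one_pos inf_le_left)
  simpa only [funext innerCount_one] using
    (Filter.tendsto_comap : Filter.Tendsto (innerCount 1) _ _)

/-- A functional whose entropies are bounded has mean entropy `0`. -/
theorem hasMeanEntropy_zero_of_bounded {ω : spinAlgebra →ₗ[ℂ] ℂ} {C : ℝ}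
    (h : ∀ Λ, entropy ω Λ ∈ Set.Icc 0 C) : HasMeanEntropy ω 0 := by
  have hC : Filter.Tendsto (fun Λ : Finset ℤ => C / (Λ.card : ℝ)) vanHove (nhds 0) :=
    (tendsto_natCast_atTop_atTop.comp tendsto_card_vanHove).const_div_atTop C
  refine tendsto_of_tendsto_of_tendsto_of_le_of_le tendsto_const_nhds hC (fun Λ => ?_) fun Λ => ?_
  · exact div_nonneg (h Λ).1 (Nat.cast_nonneg _)
  · exact div_le_div_of_nonneg_right (h Λ).2 (Nat.cast_nonneg _)

theorem HasMeanEntropy.meanEntropy_eq {ω : spinAlgebra →ₗ[ℂ] ℂ} {s : ℝ}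
    (h : HasMeanEntropy ω s) : meanEntropy ω = s :=
  Filter.Tendsto.limUnder_eq h

/-! ### Density matrices after a measurement -/

open Classical in
theorem matrixUnit_productFun {Λ T : Finset ℤ} (hT : Λ ⊆ T) (η ξ : Λ → Fin 2) {ψ : Spinor}
    (w : ℤ → Fin 2 → ℂ) (f : ChainSpace) (hf : ⇑f = productFun ψ T w) :
    ⇑((matrixUnit Λ η ξ : ChainSpace →L[ℂ] ChainSpace) f) = productFun ψ T fun x =>
      (if h : x ∈ Λ then Matrix.single (η ⟨x, h⟩) (ξ ⟨x, h⟩) (1 : ℂ) else 1) *ᵥ w x := by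
  refine list_prod_site_productFun Subtype.val_injective
    (fun x => Matrix.single (η x) (ξ x) (1 : ℂ)) hf _ (Finset.sort_nodup _ _)
    (fun x _ => hT x.2) _ (fun x _ => ?_) (fun x hx => ?_)
  · rw [dif_pos x.2]
  · rw [dif_neg, Matrix.one_mulVec]
    exact fun h => hx ⟨x, h⟩ (by simp) rfl

/-- In a product state, the measured outcomes leave a density matrix of rank one. -/
theorem exists_vectorFunctional_matrixUnit (s : EuclideanSpace ℝ (Fin 3)) {n : ℕ}
    (α : Fin n → Fin 2) (ψ : Spinor) (Λ : Finset ℤ) :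
    ∃ b : (Λ → Fin 2) → ℂ,
      (∀ ξ η, vectorFunctional (productVector ψ)
        (historyProj s α * matrixUnit Λ η ξ * historyProj s α) = b ξ * star (b η)) ∧
      vectorFunctional (productVector ψ) (historyProj s α * 1 * historyProj s α) =
        ∑ ξ, b ξ * star (b ξ) := by
  classical
  -- Large enough for the matrix unit and for the history projection; the sites of `T \ Λ` are all
  -- measured ones.
  set T : Finset ℤ := Λ ∪ Finset.univ.image fun i : Fin n => (i : ℤ) + 1
  have hΛ : Λ ⊆ T := Finset.subset_union_left
  have hT : ∀ i : Fin n, (i : ℤ) + 1 ∈ T := fun i => Finset.mem_union_right _ (by simp)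
  set u : ℤ → Fin 2 → ℂ := fun x => outcomeAt s α x *ᵥ ψ.1.ofLp
  -- The squared norm of the measured factors outside `Λ`. It may differ from 1, since the
  -- projections shorten the vectors; its square root is absorbed into `b`.
  set a : ℝ := ∏ x ∈ T \ Λ, ∑ i, ‖u x i‖ ^ 2
  have ha : 0 ≤ a := by positivity
  have hu : ∀ x, star (u x) ⬝ᵥ u x = ((∑ i, ‖u x i‖ ^ 2 : ℝ) : ℂ) := fun x => by
    simp [dotProduct, Complex.conj_mul']
  have split : ∀ h : ℤ → ℂ, (∀ x ∈ T \ Λ, h x = star (u x) ⬝ᵥ u x) →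
      ∏ x ∈ T, h x = ((√a : ℝ) : ℂ) * ((√a : ℝ) : ℂ) * ∏ x : Λ, h x := by
    intro h hh
    rw [← Finset.prod_sdiff hΛ, Finset.prod_coe_sort Λ h, ← Complex.ofReal_mul,
      Real.mul_self_sqrt ha, Complex.ofReal_prod]
    congr 1
    exact Finset.prod_congr rfl fun x hx => by rw [hh x hx, hu]
  refine ⟨fun ξ => ((√a : ℝ) : ℂ) * ∏ x : Λ, u x (ξ x), fun ξ η => ?_, ?_⟩
  · rw [vectorFunctional_historyProj s α ψ hT _ _ (matrixUnit_productFun hΛ η ξ), split]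
    · rw [Finset.prod_congr rfl fun (x : Λ) _ => show _ = u x (ξ x) * star (u x (η x)) by
        rw [dif_pos x.2, Matrix.single_mulVec, ← Pi.single, dotProduct_single]
        simp [u, mul_comm]]
      simp only [Finset.prod_mul_distrib, star_mul', star_prod, Complex.star_def,
        Complex.conj_ofReal]
      ring
    · intro x hx
      rw [dif_neg (Finset.mem_sdiff.mp hx).2, Matrix.one_mulVec]
  · rw [vectorFunctional_historyProj s α ψ hT 1 1 (fun w f hf => by simpa using hf), split]
    · have h1 : ∀ x : Λ, star (u x) ⬝ᵥ u x = ∑ i, u x i * star (u x i) := fun x => by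
        simp [dotProduct, mul_comm]
      simp only [u] at h1
      simp only [Pi.one_apply, Matrix.one_mulVec, h1, Finset.prod_univ_sum,
        Fintype.piFinset_univ, Finset.mul_sum, star_mul', star_prod, Finset.prod_mul_distrib,
        Complex.star_def, Complex.conj_ofReal, u]
      exact Finset.sum_congr rfl fun ξ _ => by ring
    · intro x _
      simp [u]

/-- A state obtained from a mixture of two product states by measuring finitely many spins has
entropies at most `2`. -/
theorem entropy_mem_Icc {s : EuclideanSpace ℝ (Fin 3)} {μ : ℝ} (h0 : 0 ≤ μ) (h1 : μ ≤ 1)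
    {ψ φ : Spinor} {n : ℕ} (α : Fin n → Fin 2) {c : ℝ} (hc : 0 ≤ c) {ω : spinAlgebra →ₗ[ℂ] ℂ}
    (hω : ∀ A, ω A = c * mixture μ ψ φ (historyProj s α * A * historyProj s α))
    (hω1 : ω 1 = 1) (Λ : Finset ℤ) : entropy ω Λ ∈ Set.Icc (0 : ℝ) 2 := by
  obtain ⟨b, hb, hb1⟩ := exists_vectorFunctional_matrixUnit s α ψ Λ
  obtain ⟨d, hd, hd1⟩ := exists_vectorFunctional_matrixUnit s α φ Λ
  have e0 : (c : ℂ) * μ = ((√(c * μ) : ℝ) : ℂ) * ((√(c * μ) : ℝ) : ℂ) := by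
    exact_mod_cast (Real.mul_self_sqrt (mul_nonneg hc h0)).symm
  have e1 : (c : ℂ) * ((1 - μ : ℝ) : ℂ) =
      ((√(c * (1 - μ)) : ℝ) : ℂ) * ((√(c * (1 - μ)) : ℝ) : ℂ) := by
    exact_mod_cast (Real.mul_self_sqrt (mul_nonneg hc (sub_nonneg.mpr h1))).symm
  -- One column for each product state, weighted by the square root of its coefficient; `B * Bᴴ`
  -- gives positivity and rank at most 2 at once.
  set B : Matrix (Λ → Fin 2) (Fin 2) ℂ := Matrix.of fun ξ j =>
    if j = 0 then ((√(c * μ) : ℝ) : ℂ) * b ξ else ((√(c * (1 - μ)) : ℝ) : ℂ) * d ξ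
  have hρ : densityMatrix ω Λ = B * Bᴴ := by
    ext ξ η
    simp only [densityMatrix, Matrix.of_apply, hω, mixture, LinearMap.add_apply,
      LinearMap.smul_apply, smul_eq_mul, hb, hd, Matrix.mul_apply, Fin.sum_univ_two,
      Matrix.conjTranspose_apply, B, if_true, one_ne_zero, if_false, Complex.star_def,
      map_mul, Complex.conj_ofReal]
    linear_combination b ξ * (starRingEnd ℂ) (b η) * e0 + d ξ * (starRingEnd ℂ) (d η) * e1
  -- The trace is matched with `ω 1` through the norm identities `hb1` and `hd1`.
  have htr : (densityMatrix ω Λ).trace = 1 := by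
    rw [← hω1, hω 1]
    simp only [Matrix.trace, Matrix.diag_apply, densityMatrix, Matrix.of_apply, hω, mixture,
      LinearMap.add_apply, LinearMap.smul_apply, smul_eq_mul, hb, hd, hb1, hd1,
      Finset.mul_sum, ← Finset.sum_add_distrib]
  have hrank : (densityMatrix ω Λ).rank ≤ 2 := by
    rw [hρ]
    exact (Matrix.rank_mul_le_left _ _).trans (by simpa using Matrix.rank_le_card_width B)
  have := trace_cfc_negMulLog_mem_Icc (hρ ▸ Matrix.posSemidef_self_mul_conjTranspose B) htr
  exact ⟨this.1, this.2.trans (by exact_mod_cast hrank)⟩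

theorem mixture_hasMeanEntropy (ψ φ : Spinor) {μ : ℝ} (h0 : 0 ≤ μ) (h1 : μ ≤ 1) :
    HasMeanEntropy (mixture μ ψ φ) 0 := by
  -- The unmeasured mixture is the case of the empty history, whose projection is 1; the direction
  -- `s` then plays no role.
  refine hasMeanEntropy_zero_of_bounded (C := 2) (entropy_mem_Icc (s := 0) h0 h1
    (ψ := ψ) (φ := φ) (Fin.elim0 : Fin 0 → Fin 2) zero_le_one (fun A => ?_) (mixture_isState ψ φ h0 h1).2)
  simp [historyProj]

/-! ### The dynamics -/

/-- The shift of the spins by one site. -/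
def spinShift : ChainSpace →L[ℂ] ChainSpace :=
  permOp (Equiv.prodCongr (Equiv.refl Spinor) translateEquiv)

theorem mem_translateEquiv {x : ℤ} {F : Finset ℤ} : x ∈ translateEquiv F ↔ x + 1 ∈ F := by
  simp only [translateEquiv, Equiv.finsetCongr_apply, Finset.mem_map_equiv]
  rfl

theorem translateEquiv_symmDiff (F : Finset ℤ) (x : ℤ) :
    translateEquiv (F ∆ {x + 1}) = translateEquiv F ∆ {x} := by
  ext y
  simp [mem_translateEquiv, Finset.mem_symmDiff]

theorem spinShift_siteOp (x : ℤ) (M : Matrix (Fin 2) (Fin 2) ℂ) (f : ChainSpace) :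
    spinShift (siteOp x M f) = siteOp (x + 1) M (spinShift f) := by
  ext ⟨ψ, F⟩
  have ho : occ x (translateEquiv F) = occ (x + 1) F := by simp [occ, mem_translateEquiv]
  change siteOp x M f (ψ, translateEquiv F) = _
  rw [siteOp_apply, siteOp_apply, ho]
  change _ = _ * f (ψ, translateEquiv F) + _ * f (ψ, translateEquiv (F ∆ {x + 1}))
  rw [translateEquiv_symmDiff]

theorem spinShift_productVector (ψ : Spinor) :
    spinShift (productVector ψ) = productVector ψ := by
  ext ⟨ψ', F⟩
  have h : translateEquiv F = ∅ ↔ F = ∅ := by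
    simp [translateEquiv]
  change productVector ψ (ψ', translateEquiv F) = _
  simp only [productVector, lp.coeFn_single, Pi.single_apply, Prod.mk.injEq, h]

theorem spinShift_systemVector (μ : ℝ) (ψ φ : Spinor) :
    spinShift (systemVector μ ψ φ) = systemVector μ ψ φ := by
  simp only [systemVector, map_add, map_smul, spinShift_productVector]

theorem spinShift_list_prod {ι : Type*} (g : ι → ℤ) (m : ι → Matrix (Fin 2) (Fin 2) ℂ)
    (f : ChainSpace) (l : List ι) :
    spinShift (((l.map fun i => site (g i) (m i)).prod : ChainSpace →L[ℂ] ChainSpace) f) =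
      ((l.map fun i => site (g i + 1) (m i)).prod : ChainSpace →L[ℂ] ChainSpace)
        (spinShift f) := by
  induction l with
  | nil => simp
  | cons i l ih =>
    simp only [List.map_cons, List.prod_cons, MulMemClass.coe_mul, mul_apply_eq_comp, site,
      spinShift_siteOp] at ih ⊢
    rw [ih]

/-- The entry `α 0` is the most recent outcome, recorded at site 1. The tail is the earlier history,
carried by the shift from sites `1, …, n` to `2, …, n + 1`; the system vector itself is shift
invariant. -/
theorem historyProj_succ (s : EuclideanSpace ℝ (Fin 3)) (μ : ℝ) (ψ φ : Spinor) {n : ℕ}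
    (α : Fin (n + 1) → Fin 2) :
    (historyProj s α : ChainSpace →L[ℂ] ChainSpace) (systemVector μ ψ φ) =
      siteOp 1 (outcome s (α 0))
        (spinShift ((historyProj s (α ∘ Fin.succ) : ChainSpace →L[ℂ] ChainSpace)
          (systemVector μ ψ φ))) := by
  rw [historyProj_eq, historyProj_eq, spinShift_list_prod, spinShift_systemVector,
    List.finRange_succ]
  simp [site, List.map_map, Function.comp_def]

theorem step_apply (s : EuclideanSpace ℝ (Fin 3)) (f : JointSpace) (F : Finset ℤ) :
    (measure s 1 ∘L shift) f F =
      siteOp 1 (outcome s 0) (spinShift (f (translateEquiv F))) +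
        siteOp 1 (outcome s 1) (spinShift (f (translateEquiv F ∆ {0}))) := by
  have h : (outcome s 1) = 1 - (1 / 2 : ℂ) • (1 + sigmaDot s) := by simp [outcome]
  have h1 : siteOp 1 (outcome s 1) = ((1 - spinProj s 1 : spinAlgebra) :
      ChainSpace →L[ℂ] ChainSpace) := by
    rw [spinProj, ← site_one 1, ← site_sub, h]
    rfl
  -- Turning pointer 1 after the shift amounts to turning pointer 0 before it.
  rw [h1, ← translateEquiv_symmDiff]
  rfl

theorem finalVector_succ (s : EuclideanSpace ℝ (Fin 3)) (μ : ℝ) (ψ φ : Spinor) (n : ℕ) :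
    finalVector s μ ψ φ (n + 1) = (measure s 1 ∘L shift) (finalVector s μ ψ φ n) := by
  rw [finalVector, pow_succ']
  rfl

theorem finalVector_zero (s : EuclideanSpace ℝ (Fin 3)) (μ : ℝ) (ψ φ : Spinor) :
    finalVector s μ ψ φ 0 = lp.single 2 ∅ (systemVector μ ψ φ) := rfl

/-- The pointers at the sites `x ≤ 0` are never turned. -/
theorem finalVector_eq_zero (s : EuclideanSpace ℝ (Fin 3)) (μ : ℝ) (ψ φ : Spinor) (n : ℕ) :
    ∀ (F : Finset ℤ) (x : ℤ), x ∈ F → x ≤ 0 → finalVector s μ ψ φ n F = 0 := by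
  induction n with
  | zero =>
    intro F x hx _
    rw [finalVector_zero, lp.coeFn_single, Pi.single_eq_of_ne (Finset.ne_empty_of_mem hx)]
  | succ n ih =>
    intro F x hx h0
    -- Before the step the pointer at `x` stood at `x - 1 < 0`, hence was not affected by the toggle
    -- at 0.
    rw [finalVector_succ, step_apply,
      ih (translateEquiv F) (x - 1) (by simpa [mem_translateEquiv] using hx) (by omega),
      ih (translateEquiv F ∆ {0}) (x - 1)
        (by simp [Finset.mem_symmDiff, mem_translateEquiv, hx]; omega) (by omega)]
    simp

theorem mem_pointers {n : ℕ} (α : Fin n → Fin 2) (x : ℤ) :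
    x ∈ pointers α ↔ ∃ i : Fin n, α i = 1 ∧ (i : ℤ) + 1 = x := by
  simp [pointers]

theorem zero_notMem_pointers {n : ℕ} (α : Fin n → Fin 2) : (0 : ℤ) ∉ pointers α := by
  rw [mem_pointers]
  rintro ⟨i, -, hi⟩
  omega

/-- Undoing the shift sends the newest pointer to site 0 and leaves the pointers of the earlier
history. -/
theorem translateEquiv_pointers {n : ℕ} (α : Fin (n + 1) → Fin 2) :
    translateEquiv (pointers α) =
      if α 0 = 0 then pointers (α ∘ Fin.succ) else pointers (α ∘ Fin.succ) ∆ {0} := by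
  have h0 := zero_notMem_pointers (α ∘ Fin.succ)
  ext x
  by_cases hx : x = 0
  · subst hx
    rw [mem_translateEquiv, mem_pointers, Fin.exists_fin_succ]
    rcases (by decide : ∀ a : Fin 2, a = 0 ∨ a = 1) (α 0) with h | h
    · simp only [h, if_true, h0, iff_false]
      simp
      intros; omega
    · simp [h, Finset.mem_symmDiff, h0]
  · have : x ∈ translateEquiv (pointers α) ↔ x ∈ pointers (α ∘ Fin.succ) := by
      rw [mem_translateEquiv, mem_pointers, mem_pointers, Fin.exists_fin_succ]
      simpa using fun _ h => absurd h hx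
    rw [this]
    split_ifs <;> simp [Finset.mem_symmDiff, hx]

/-- Of the two terms in `step_apply`, the one that would need pointer 0 up before the step vanishes;
the survivor carries the outcome `α 0`. Thus distinct histories never interfere. -/
theorem historyVector_eq (s : EuclideanSpace ℝ (Fin 3)) (μ : ℝ) (ψ φ : Spinor) {n : ℕ}
    (α : Fin n → Fin 2) :
    historyVector s μ ψ φ α =
      (historyProj s α : ChainSpace →L[ℂ] ChainSpace) (systemVector μ ψ φ) := by
  induction n with
  | zero =>
    have : pointers α = ∅ := by simp [pointers]
    rw [historyVector, this, finalVector_zero]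
    simp [historyProj]
  | succ n ih =>
    have hz : finalVector s μ ψ φ n (pointers (α ∘ Fin.succ) ∆ {0}) = 0 := by
      refine finalVector_eq_zero s μ ψ φ n _ 0 ?_ le_rfl
      simp [Finset.mem_symmDiff, zero_notMem_pointers]
    rw [historyProj_succ, ← ih, historyVector, finalVector_succ, step_apply,
      translateEquiv_pointers, historyVector]
    rcases (by decide : ∀ a : Fin 2, a = 0 ∨ a = 1) (α 0) with h | h
    · simp [h, hz]
    · simp [h, hz]

/-! ### The state after a measurement -/

theorem vectorFunctional_historyVector {s : EuclideanSpace ℝ (Fin 3)} (hs : ‖s‖ = 1) {μ : ℝ}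
    (h0 : 0 ≤ μ) (h1 : μ ≤ 1) {ψ φ : Spinor} (hne : ψ ≠ φ) {n : ℕ} (α : Fin n → Fin 2) (A : spinAlgebra) :
    vectorFunctional (historyVector s μ ψ φ α) A =
      mixture μ ψ φ (historyProj s α * A * historyProj s α) := by
  rw [historyVector_eq, vectorFunctional_apply_vector, vectorFunctional_systemVector hne h0 h1,
    (historyProj_isStarProjection hs α).isSelfAdjoint.star_eq]

theorem historyProb_eq {s : EuclideanSpace ℝ (Fin 3)} (hs : ‖s‖ = 1) {μ : ℝ}
    (h0 : 0 ≤ μ) (h1 : μ ≤ 1) {ψ φ : Spinor} (hne : ψ ≠ φ) {n : ℕ} (α : Fin n → Fin 2) :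
    (historyProb s μ ψ φ α : ℂ) = mixture μ ψ φ (historyProj s α) := by
  rw [historyProb, ← vectorFunctional_one, vectorFunctional_historyVector hs h0 h1 hne, mul_one,
    (historyProj_isStarProjection hs α).isIdempotentElem.eq]

theorem collapsed_apply {s : EuclideanSpace ℝ (Fin 3)} (hs : ‖s‖ = 1) {μ : ℝ}
    (h0 : 0 ≤ μ) (h1 : μ ≤ 1) {ψ φ : Spinor} (hne : ψ ≠ φ) {n : ℕ} (α : Fin n → Fin 2)
    (A : spinAlgebra) :
    collapsed s μ ψ φ α A = (historyProb s μ ψ φ α : ℂ)⁻¹ *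
      mixture μ ψ φ (historyProj s α * A * historyProj s α) := by
  rw [collapsed, LinearMap.smul_apply, vectorFunctional_historyVector hs h0 h1 hne, smul_eq_mul]

theorem collapsed_isState (s : EuclideanSpace ℝ (Fin 3)) (μ : ℝ) (ψ φ : Spinor) {n : ℕ}
    (α : Fin n → Fin 2) (h : historyProb s μ ψ φ α ≠ 0) : IsState (collapsed s μ ψ φ α) := by
  constructor
  · intro A
    simp only [collapsed, LinearMap.smul_apply, smul_eq_mul, vectorFunctional_star_mul_self]
    norm_cast
    have : 0 ≤ historyProb s μ ψ φ α := sq_nonneg _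
    positivity
  · rw [collapsed, LinearMap.smul_apply, vectorFunctional_one, smul_eq_mul]
    exact inv_mul_cancel₀ (Complex.ofReal_ne_zero.mpr h)

theorem collapsed_hasMeanEntropy {s : EuclideanSpace ℝ (Fin 3)} (hs : ‖s‖ = 1) {μ : ℝ}
    (h0 : 0 ≤ μ) (h1 : μ ≤ 1) {ψ φ : Spinor} (hne : ψ ≠ φ) {n : ℕ} (α : Fin n → Fin 2)
    (h : historyProb s μ ψ φ α ≠ 0) : HasMeanEntropy (collapsed s μ ψ φ α) 0 := by
  refine hasMeanEntropy_zero_of_bounded (entropy_mem_Icc (s := s) (ψ := ψ) (φ := φ) h0 h1 α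
    (inv_nonneg.mpr (sq_nonneg _ : 0 ≤ historyProb s μ ψ φ α)) (fun A => ?_)
    (collapsed_isState s μ ψ φ α h).2)
  rw [Complex.ofReal_inv, collapsed_apply hs h0 h1 hne]
  rfl

/-- The matrix `σ · (n - m)` annihilates `ψ`, while its square is the scalar `|n - m|²`; as `ψ` is
nonzero, the scalar vanishes. -/
theorem eq_of_sigmaDot_mulVec_eq {n m : EuclideanSpace ℝ (Fin 3)} {ψ : Spinor}
    (hn : (sigmaDot n).mulVec ψ.1.ofLp = ψ.1.ofLp)
    (hm : (sigmaDot m).mulVec ψ.1.ofLp = ψ.1.ofLp) : n = m := by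
  have hsub : sigmaDot (n - m) = sigmaDot n - sigmaDot m := by
    simp only [sigmaDot, PiLp.sub_apply, Complex.ofReal_sub]
    module
  have h0 : sigmaDot (n - m) *ᵥ ψ.1.ofLp = 0 := by
    rw [hsub, Matrix.sub_mulVec, hn, hm, sub_self]
  have h1 : ((‖n - m‖ ^ 2 : ℝ) : ℂ) • ψ.1.ofLp = 0 := by
    have := congrArg (sigmaDot (n - m) *ᵥ ·) h0
    simpa only [Matrix.mulVec_mulVec, sigmaDot_mul_self, Matrix.smul_mulVec, Matrix.one_mulVec,
      Matrix.mulVec_zero] using this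
  rcases smul_eq_zero.mp h1 with h | h
  · exact sub_eq_zero.mp (norm_eq_zero.mp (pow_eq_zero_iff two_ne_zero |>.mp
      (Complex.ofReal_eq_zero.mp h)))
  · have hψ : ‖ψ.1‖ = 1 := by simp
    have : ψ.1 = 0 := by ext i; simpa using congrFun h i
    simp [this] at hψ

end SpinChain

end

open SpinChain in
theorem theorem5p1
    (n m s : EuclideanSpace ℝ (Fin 3)) (hn : ‖n‖ = 1) (hm : ‖m‖ = 1) (hnm : n ≠ m) (hs : ‖s‖ = 1)
    (ψ φ : Spinor)
    (hψ : (sigmaDot n).mulVec ψ.1.ofLp = ψ.1.ofLp) (hφ : (sigmaDot m).mulVec φ.1.ofLp = φ.1.ofLp)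
    (μ : ℝ) (hμ0 : 0 < μ) (hμ1 : μ < 1) (N : ℕ) :
    IsState (mixture μ ψ φ) ∧
    HasMeanEntropy (mixture μ ψ φ) (meanEntropy (mixture μ ψ φ)) ∧
    (∀ α : Fin N → Fin 2,
      (historyProb s μ ψ φ α : ℂ) = mixture μ ψ φ (historyProj s α)) ∧
    (∀ α : Fin N → Fin 2, historyProb s μ ψ φ α ≠ 0 →
      IsState (collapsed s μ ψ φ α) ∧
      (∀ A : spinAlgebra, collapsed s μ ψ φ α A =
        (historyProb s μ ψ φ α : ℂ)⁻¹ *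
          mixture μ ψ φ (historyProj s α * A * historyProj s α)) ∧
      HasMeanEntropy (collapsed s μ ψ φ α) (meanEntropy (collapsed s μ ψ φ α))) ∧
    ∑ α : Fin N → Fin 2, historyProb s μ ψ φ α * meanEntropy (collapsed s μ ψ φ α) =
      meanEntropy (mixture μ ψ φ) := by
  have hne : ψ ≠ φ := by
    rintro rfl
    exact hnm (eq_of_sigmaDot_mulVec_eq hψ hφ)
  have h0 := hμ0.le
  have h1 := hμ1.le
  have hmix := mixture_hasMeanEntropy ψ φ h0 h1
  refine ⟨mixture_isState ψ φ h0 h1, hmix.meanEntropy_eq.symm ▸ hmix,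
    fun α => historyProb_eq hs h0 h1 hne α, fun α hα => ?_, ?_⟩
  · have hcol := collapsed_hasMeanEntropy hs h0 h1 hne α hα
    exact ⟨collapsed_isState s μ ψ φ α hα, fun A => collapsed_apply hs h0 h1 hne α A,
      hcol.meanEntropy_eq.symm ▸ hcol⟩
  · rw [hmix.meanEntropy_eq]
    refine Finset.sum_eq_zero fun α _ => ?_
    -- For an impossible history the value of `meanEntropy` is irrelevant, because its weight is
    -- zero.
    by_cases hα : historyProb s μ ψ φ α = 0
    · rw [hα, zero_mul]
    · rw [(collapsed_hasMeanEntropy hs h0 h1 hne α hα).meanEntropy_eq, mul_zero]
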